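/- Let $n\ge 1$, let $T^n=(S^1)^n$ with $S^1\subset\mathbb C$ the unit circle, and let $$K_n=(S^1)^n/\big((z_1,\ldots,z_{n-1},z_n)\sim(\overline z_1,\ldots,\overline z_{n-1},-z_n)\big)$$ be the $n$-dimensional Klein bottle, with quotient map $p:T^n\to K_n$ and base points $1=(1,\ldots,1)\in T^n$ and $p(1)\in K_n$. For $1\le j\le n$ let $g_j\in\pi_1(T^n,1)$ be the class of the loop $t\mapsto(1^{j-1},e^{2\pi i t},1^{n-j})$, $0\le t\le 1$, and let $a_j\in\pi_1(K_n,p(1))$ be the class of the loop $$f_j(t)=\begin{cases}[(1^{j-1},e^{2\pi i t},1^{n-j})]& j<n,\\ [(1^{n-1},e^{\pi i t})]& j=n.\end{cases}$$ Then $\pi_1(K_n,p(1))$ is presented by the generators $a_1,\ldots,a_n$ with the relations $a_ja_n=a_na_j^{-1}$ for $1\le j\le n-1$ and $a_ia_j=a_ja_i$ for $1\le i<j\le n-1$; that is, the homomorphism from the abstract group with this presentation sending the $j$-th generator to $a_j$ is well defined and an isomorphism. Moreover $p$ is a double cover (a covering map all of whose fibres have exactly two points), and the induced homomorphism $p_*:\pi_1(T^n,1)\to\pi_1(K_n,p(1))$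 satisfies $p_*(g_j)=a_j$ for $j<n$ and $p_*(g_n)=a_n^2$. -/

import Mathlib

namespace KleinBottle

/-- The `n`-torus `T^n = (S^1)^n`, with the product topology; coordinates are indexed by
`0, …, n - 1`, so the last coordinate `z_n` is the one with index `j` such that `j + 1 = n`. -/
abbrev Torus (n : ℕ) : Type := Fin n → Circle

/-- The involution `(z_1, …, z_{n-1}, z_n) ↦ (conj z_1, …, conj z_{n-1}, -z_n)` of the torus.
On the unit circle the inverse is the complex conjugate, see `coe_involution`. -/
noncomputable def involution (n : ℕ) (z : Torus n) : Torus n :=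
  fun j => if (j : ℕ) + 1 = n then -z j else (z j)⁻¹

theorem coe_involution (n : ℕ) (z : Torus n) (j : Fin n) :
    (involution n z j : ℂ) =
      if (j : ℕ) + 1 = n then -(z j : ℂ) else (starRingEnd ℂ) (z j : ℂ) := by
  unfold involution
  split_ifs
  · exact Circle.coe_neg _
  · exact Circle.coe_inv_eq_conj _

theorem involution_involution (n : ℕ) (z : Torus n) :
    involution n (involution n z) = z := by
  funext j
  unfold involution
  split_ifs <;> simp

/-- The equivalence relation identifying `z` with `involution n z`. -/
def kleinSetoid (n : ℕ) : Setoid (Torus n) where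
  r z w := w = z ∨ w = involution n z
  iseqv :=
    { refl := fun _ => Or.inl rfl
      symm := by
        rintro z w (rfl | rfl)
        · exact Or.inl rfl
        · exact Or.inr (involution_involution n z).symm
      trans := by
        rintro z w v (rfl | rfl) (rfl | rfl)
        · exact Or.inl rfl
        · exact Or.inr rfl
        · exact Or.inr rfl
        · exact Or.inl (involution_involution n z) }

/-- The `n`-dimensional Klein bottle `K_n = (S^1)^n / (z ∼ involution n z)`. -/
def K (n : ℕ) : Type := Quotient (kleinSetoid n)

/-- `K_n` carries the quotient topology. -/
instance (n : ℕ) : TopologicalSpace (K n) :=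
  inferInstanceAs (TopologicalSpace (Quotient (kleinSetoid n)))

/-- The quotient map `p : T^n → K_n`. -/
def proj (n : ℕ) : C(Torus n, K n) where
  toFun := Quotient.mk (kleinSetoid n)
  continuous_toFun := continuous_quot_mk

theorem proj_involution (n : ℕ) (z : Torus n) : proj n (involution n z) = proj n z :=
  Quotient.sound (s := kleinSetoid n) (Or.inr (involution_involution n z).symm)

/-- The arc `t ↦ (1, …, 1, e^{iθt}, 1, …, 1)` in the torus, with `e^{iθt}` in place `j`. -/
noncomputable def arc (n : ℕ) (j : Fin n) (θ : ℝ) (t : unitInterval) : Torus n :=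
  Pi.mulSingle j (Circle.exp (θ * (t : ℝ)))

theorem continuous_arc (n : ℕ) (j : Fin n) (θ : ℝ) : Continuous (arc n j θ) := by
  unfold arc
  exact (continuous_mulSingle j).comp (by fun_prop)

theorem arc_zero (n : ℕ) (j : Fin n) (θ : ℝ) : arc n j θ 0 = 1 := by
  simp [arc]

theorem arc_two_pi_one (n : ℕ) (j : Fin n) : arc n j (2 * Real.pi) 1 = 1 := by
  simp [arc]

theorem arc_pi_one (n : ℕ) (j : Fin n) (hj : (j : ℕ) + 1 = n) :
    arc n j Real.pi 1 = involution n 1 := by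
  funext i
  unfold arc involution
  by_cases h : i = j
  · subst h
    have hpi : Circle.exp Real.pi = -1 := by
      apply Circle.ext
      simp [Complex.exp_pi_mul_I]
    simp [hj, hpi]
  · have hi : ¬ (i : ℕ) + 1 = n := fun hi => h (Fin.ext (by omega))
    simp [hi, h]

/-- The loop `t ↦ (1, …, 1, e^{2πit}, 1, …, 1)` in `T^n` around the `j`-th circle factor. -/
noncomputable def torusLoop (n : ℕ) (j : Fin n) : Path (1 : Torus n) 1 where
  toFun := arc n j (2 * Real.pi)
  continuous_toFun := continuous_arc n j _
  source' := arc_zero n j _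
  target' := arc_two_pi_one n j

/-- The loop `f_j` in `K_n` based at `[(1, …, 1)]`: for `j` not the last index it is
`t ↦ [(1, …, 1, e^{2πit}, 1, …, 1)]` with `e^{2πit}` in place `j`, and for the last index it is
`t ↦ [(1, …, 1, e^{πit})]`. -/
noncomputable def kleinLoop (n : ℕ) (j : Fin n) : Path (proj n 1) (proj n 1) where
  toFun t := proj n (arc n j (if (j : ℕ) + 1 = n then Real.pi else 2 * Real.pi) t)
  continuous_toFun := (proj n).continuous.comp (continuous_arc n j _)
  source' := by rw [arc_zero]
  target' := by
    split_ifs with hj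
    · rw [arc_pi_one n j hj, proj_involution]
    · rw [arc_two_pi_one]

/-- The standard generator `g_j` of `π_1(T^n)`. -/
noncomputable def g (n : ℕ) (j : Fin n) : FundamentalGroup (Torus n) 1 :=
  FundamentalGroup.fromPath (Path.Homotopic.Quotient.mk (torusLoop n j))

/-- The class `a_j = [f_j]` in `π_1(K_n)`. -/
noncomputable def a (n : ℕ) (j : Fin n) : FundamentalGroup (K n) (proj n 1) :=
  FundamentalGroup.fromPath (Path.Homotopic.Quotient.mk (kleinLoop n j))

/-- The relators expressing `a_j a_n = a_n a_j⁻¹` for `j < n`, and `a_i a_j = a_j a_i` for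
`i < j < n`.  Each relation is unchanged, up to equivalence, when the order of
multiplication is reversed (the first one says `a_j a_n a_j = a_n`), so it does not matter that
Mathlib's product in the fundamental group runs through its second factor first. -/
def relators (n : ℕ) : Set (FreeGroup (Fin n)) :=
  {r | ∃ j l : Fin n, (j : ℕ) + 1 < n ∧ (l : ℕ) + 1 = n ∧
      r = (FreeGroup.of j * FreeGroup.of l) * (FreeGroup.of l * (FreeGroup.of j)⁻¹)⁻¹} ∪
  {r | ∃ i j : Fin n, i < j ∧ (j : ℕ) + 1 < n ∧
      r = (FreeGroup.of i * FreeGroup.of j) * (FreeGroup.of j * FreeGroup.of i)⁻¹}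

end KleinBottle

namespace KleinBottle

/-! Write `n = m + 1`. The group `ℤ^m ⋊ ℤ`, whose `ℤ` factor acts by inversion, acts freely on
`ℝ^(m+1)` by integer translations, with odd elements of `ℤ` also negating the first `m` coordinates.
Its orbits are exactly the fibres of `ℝ^(m+1) → T^n → K_n` (`kleinCover_eq_iff`), and small balls
are disjoint from their translates, so this composite is a covering with simply connected total
space and `π_1(K_n)` is the deck group. Since `f_j` lifts to the segment from `0` to the `j`-th
basis vector, `a_j` corresponds to the `j`-th standard generator (`fundamentalGroupEquivDeck_a`).

Purely algebraically, the presented group is the same semidirect product with the same generators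
(`presentedEquivDeck`). The double cover comes from the free involution, and `p_*` is computed
directly on loops. -/

theorem proj_eq_iff {n : ℕ} {z w : Torus n} :
    proj n z = proj n w ↔ w = z ∨ w = involution n z :=
  Quotient.eq (r := kleinSetoid n)

theorem continuous_involution (n : ℕ) : Continuous (involution n) := by
  refine continuous_pi fun j => ?_
  unfold involution
  split_ifs <;> fun_prop

/-! ### The double cover and its effect on loops. -/

theorem involution_ne_self {n : ℕ} (hn : 1 ≤ n) (z : Torus n) : involution n z ≠ z := by
  intro h
  have hl := congrArg (fun w : Torus n => (w ⟨n - 1, by omega⟩ : ℂ)) h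
  simp only [coe_involution] at hl
  rw [if_pos (by omega), neg_eq_self] at hl
  exact Circle.coe_ne_zero _ hl

theorem isQuotientMap_proj (n : ℕ) : Topology.IsQuotientMap (proj n) :=
  isQuotientMap_quot_mk

theorem ncard_preimage_proj {n : ℕ} (hn : 1 ≤ n) (x : K n) :
    (proj n ⁻¹' {x}).ncard = 2 := by
  obtain ⟨z, rfl⟩ := (isQuotientMap_proj n).surjective x
  have : proj n ⁻¹' {proj n z} = {z, involution n z} := by
    ext w
    simp only [Set.mem_preimage, Set.mem_singleton_iff, Set.mem_insert_iff]
    rw [eq_comm, proj_eq_iff]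
  rw [this, Set.ncard_pair (involution_ne_self hn z).symm]

/-- The action of `ℤˣ = {1, -1}` on the torus in which `-1` acts by the involution. -/
@[reducible]
noncomputable def involutionAction (n : ℕ) : MulAction ℤˣ (Torus n) where
  smul u z := if u = 1 then z else involution n z
  one_smul _ := if_pos rfl
  mul_smul u v z := by
    change (if u * v = 1 then z else involution n z) =
      if u = 1 then (if v = 1 then z else involution n z)
      else involution n (if v = 1 then z else involution n z)
    rcases Int.units_eq_one_or u with rfl | rfl <;>
      rcases Int.units_eq_one_or v with rfl | rfl <;>
      simp [involution_involution]

/-- A free action of a finite group on a Hausdorff space is properly discontinuous, so the orbit map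
is a covering. -/
theorem isCoveringMap_proj {n : ℕ} (hn : 1 ≤ n) : IsCoveringMap (proj n) := by
  let := involutionAction n
  have h1 (z : Torus n) : (1 : ℤˣ) • z = z := one_smul _ z
  have h2 (z : Torus n) : (-1 : ℤˣ) • z = involution n z := if_neg (by decide)
  have : ContinuousConstSMul ℤˣ (Torus n) := ⟨fun u => by
    rcases Int.units_eq_one_or u with rfl | rfl
    · simpa only [h1] using continuous_id'
    · simpa only [h2] using continuous_involution n⟩
  have : IsCancelSMul ℤˣ (Torus n) := by
    refine isCancelSMul_iff_eq_one_of_smul_eq.mpr fun u z hu => ?_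
    rcases Int.units_eq_one_or u with rfl | rfl
    · rfl
    · exact absurd ((h2 z).symm.trans hu) (involution_ne_self hn z)
  refine ((isQuotientMap_proj n).isQuotientCoveringMap_of_properlyDiscontinuousSMul
    (G := ℤˣ) fun {z w} => ?_).isCoveringMap
  rw [eq_comm, proj_eq_iff]
  constructor
  · rintro (rfl | rfl)
    · exact ⟨1, h1 _⟩
    · exact ⟨-1, h2 _⟩
  · rintro ⟨u, rfl⟩
    rcases Int.units_eq_one_or u with rfl | rfl
    · exact Or.inl (h1 _)
    · exact Or.inr (h2 _)

theorem map_proj_g (n : ℕ) (j : Fin n) :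
    FundamentalGroup.map (proj n) 1 (g n j) =
      if (j : ℕ) + 1 = n then a n j ^ 2 else a n j := by
  have hmap : FundamentalGroup.map (proj n) 1 (g n j) = FundamentalGroup.fromPath
      (Path.Homotopic.Quotient.mk ((torusLoop n j).map (proj n).continuous)) := rfl
  rw [hmap]
  split_ifs with hj
  · have hsq : a n j ^ 2 = FundamentalGroup.fromPath
        (Path.Homotopic.Quotient.mk ((kleinLoop n j).trans (kleinLoop n j))) := pow_two _
    rw [hsq]
    congr 2
    ext t
    change proj n (arc n j (2 * Real.pi) t) = _
    rw [Path.trans_apply]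
    split_ifs with ht
    · change _ = proj n (arc n j (if _ then _ else _) _)
      rw [if_pos hj]
      congr 1
      simp only [arc]
      ring_nf
    · change _ = proj n (arc n j (if _ then _ else _) _)
      rw [if_pos hj, proj_eq_iff]
      -- In the second half, `e^{2πit}` and `e^{πi(2t-1)}` differ by the sign `e^{πi} = -1`, which
      -- is the involution on the last coordinate; the other coordinates are `1`.
      right
      funext i
      by_cases h : i = j
      · subst h
        simp only [arc, involution, if_pos hj, Pi.mulSingle_eq_same]
        rw [show Real.pi * (2 * (t : ℝ) - 1) = 2 * Real.pi * t - Real.pi by ring, Circle.exp_sub]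
        apply Circle.ext
        simp [Complex.exp_pi_mul_I, div_neg]
      · have hi : ¬ (i : ℕ) + 1 = n := fun hi => h (Fin.ext (by omega))
        simp [arc, involution, hi, h]
  · congr 2
    ext t
    change proj n (arc n j (2 * Real.pi) t) = proj n (arc n j (if _ then _ else _) _)
    rw [if_neg hj]


/-! ### The presented group as a semidirect product. -/

/-- The action of `ℤ` on `ℤ^m` in which the generator acts by inversion. -/
def inversionHom (m : ℕ) : Multiplicative ℤ →* MulAut (Fin m → Multiplicative ℤ) :=
  zpowersHom _ (MulEquiv.inv _)

/-- The group `ℤ^m ⋊ ℤ`, the generator of `ℤ` acting by inversion. -/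
abbrev DeckGroup (m : ℕ) : Type :=
  (Fin m → Multiplicative ℤ) ⋊[inversionHom m] Multiplicative ℤ

theorem inversionHom_ofAdd_one (m : ℕ) (v : Fin m → Multiplicative ℤ) :
    inversionHom m (Multiplicative.ofAdd 1) v = v⁻¹ := by
  simp [inversionHom]

theorem toAdd_inversionHom (m : ℕ) (k : Multiplicative ℤ) (v : Fin m → Multiplicative ℤ)
    (i : Fin m) :
    (((inversionHom m k v i).toAdd : ℤ) : ℝ) = (-1) ^ k.toAdd * ((v i).toAdd : ℝ) := by
  have hsq : (MulEquiv.inv (Fin m → Multiplicative ℤ) : MulAut _) ^ (2 : ℤ) = 1 := by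
    ext v i
    rw [zpow_two, MulAut.mul_apply]
    simp
  rcases Int.even_or_odd' k.toAdd with ⟨r, hr | hr⟩
  · simp [inversionHom, hr, zpow_mul, hsq]
  · simp [inversionHom, hr, zpow_mul, hsq, zpow_add, zpow_add₀]

/-- The generators of `DeckGroup m`, indexed by `Fin (m + 1)`. -/
def deckGen (m : ℕ) (j : Fin (m + 1)) : DeckGroup m :=
  Fin.lastCases (SemidirectProduct.inr (Multiplicative.ofAdd 1))
    (fun i => SemidirectProduct.inl (Pi.mulSingle i (Multiplicative.ofAdd 1))) j

@[simp] theorem deckGen_last (m : ℕ) :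
    deckGen m (Fin.last m) = SemidirectProduct.inr (Multiplicative.ofAdd 1) := by
  simp [deckGen]

@[simp] theorem deckGen_castSucc (m : ℕ) (i : Fin m) :
    deckGen m i.castSucc =
      SemidirectProduct.inl (Pi.mulSingle i (Multiplicative.ofAdd 1)) := by
  simp [deckGen]

/-- A family in a group satisfies the relators of the Klein bottle group if and only if it satisfies
the commutation relations. -/
theorem lift_relators_eq_one_iff {H : Type*} [Group H] (m : ℕ) (f : Fin (m + 1) → H) :
    (∀ r ∈ relators (m + 1), FreeGroup.lift f r = 1) ↔
      (∀ i : Fin m, f i.castSucc * f (Fin.last m) = f (Fin.last m) * (f i.castSucc)⁻¹) ∧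
      ∀ i j : Fin m, Commute (f i.castSucc) (f j.castSucc) := by
  constructor
  · intro h
    refine ⟨fun i => ?_, ?_⟩
    · have := h _ (Or.inl ⟨i.castSucc, Fin.last m, by simp, by simp, rfl⟩)
      rw [map_mul, map_inv, mul_inv_eq_one] at this
      simpa using this
    · have key (i j : Fin m) (hij : i < j) : Commute (f i.castSucc) (f j.castSucc) := by
        have := h _ (Or.inr ⟨i.castSucc, j.castSucc, by simpa using hij, by simp, rfl⟩)
        rw [map_mul, map_inv, mul_inv_eq_one] at this
        simpa [commute_iff_eq] using this
      intro i j
      rcases lt_trichotomy i j with hij | rfl | hij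
      · exact key i j hij
      · exact Commute.refl _
      · exact (key j i hij).symm
  · rintro ⟨h1, h2⟩ r (⟨j, l, hj, hl, rfl⟩ | ⟨i, j, hij, hj, rfl⟩)
    · obtain rfl : l = Fin.last m := Fin.ext (by simpa using hl)
      obtain ⟨i, rfl⟩ : ∃ i : Fin m, i.castSucc = j := ⟨⟨j, by omega⟩, rfl⟩
      rw [map_mul, map_inv, mul_inv_eq_one]
      simpa using h1 i
    · have hij' : (i : ℕ) < j := hij
      obtain ⟨j, rfl⟩ : ∃ j' : Fin m, j'.castSucc = j := ⟨⟨j, by omega⟩, rfl⟩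
      obtain ⟨i, rfl⟩ : ∃ i' : Fin m, i'.castSucc = i := ⟨⟨i, by simp at hij'; omega⟩, rfl⟩
      rw [map_mul, map_inv, mul_inv_eq_one]
      simpa using (h2 i j).eq

theorem deckGen_relators (m : ℕ) :
    ∀ r ∈ relators (m + 1), FreeGroup.lift (deckGen m) r = 1 := by
  refine (lift_relators_eq_one_iff m _).mpr ⟨fun i => ?_, fun i j => ?_⟩
  · rw [deckGen_last, deckGen_castSucc, ← map_inv]
    ext <;> simp [inversionHom_ofAdd_one]
  · rw [deckGen_castSucc, deckGen_castSucc]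
    exact (Commute.all _ _).map _

theorem presented_relations (m : ℕ) :
    (∀ i : Fin m, (PresentedGroup.of i.castSucc * PresentedGroup.of (Fin.last m) :
        PresentedGroup (relators (m + 1))) =
          PresentedGroup.of (Fin.last m) * (PresentedGroup.of i.castSucc)⁻¹) ∧
      ∀ i j : Fin m, Commute (PresentedGroup.of i.castSucc : PresentedGroup (relators (m + 1)))
        (PresentedGroup.of j.castSucc) := by
  refine (lift_relators_eq_one_iff m (PresentedGroup.of (rels := relators (m + 1)))).mp
    fun r hr => ?_
  rw [← PresentedGroup.one_of_mem hr]
  congr 1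
  ext; simp [PresentedGroup.of]

/-- The homomorphism from `ℤ^m` to the presented group. -/
def latticeHom (m : ℕ) :
    (Fin m → Multiplicative ℤ) →* PresentedGroup (relators (m + 1)) :=
  MonoidHom.noncommPiCoprod (fun i => zpowersHom _ (PresentedGroup.of i.castSucc))
    (by
      intro i j _ x y
      simpa using ((presented_relations m).2 i j).zpow_zpow x.toAdd y.toAdd)

theorem latticeHom_mulSingle (m : ℕ) (i : Fin m) :
    latticeHom m (Pi.mulSingle i (Multiplicative.ofAdd 1)) = PresentedGroup.of i.castSucc := by
  refine (MonoidHom.noncommPiCoprod_mulSingle _ _ _).trans ?_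
  simp

/-- Both sides are homomorphisms in `v`, so it suffices to check basis vectors, where this is the
relation `a_j a_n = a_n a_j⁻¹`. -/
theorem latticeHom_inv (m : ℕ) (v : Fin m → Multiplicative ℤ) :
    latticeHom m v⁻¹ =
      PresentedGroup.of (Fin.last m) * latticeHom m v * (PresentedGroup.of (Fin.last m))⁻¹ := by
  have h : (latticeHom m).comp (MulEquiv.inv _).toMonoidHom =
      (MulAut.conj (PresentedGroup.of (Fin.last m))).toMonoidHom.comp (latticeHom m) := by
    refine MonoidHom.pi_ext fun i x => ?_
    have hx : (Pi.mulSingle i x : Fin m → Multiplicative ℤ) =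
        Pi.mulSingle i (Multiplicative.ofAdd 1) ^ x.toAdd := by
      rw [← Pi.mulSingle_zpow, ← ofAdd_zsmul]; simp
    rw [hx, map_zpow, map_zpow]
    congr 1
    simp only [MonoidHom.comp_apply, MulEquiv.toMonoidHom_eq_coe, MonoidHom.coe_coe,
      MulEquiv.inv_apply, map_inv, latticeHom_mulSingle, MulAut.conj_apply]
    rw [eq_mul_inv_iff_mul_eq, inv_mul_eq_iff_eq_mul, ← mul_assoc,
      (presented_relations m).1 i, inv_mul_cancel_right]
  simpa using DFunLike.congr_fun h v

/-- The compatibility needed by `SemidirectProduct.lift`, by induction on `k` in both directions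
from `latticeHom_inv`. -/
theorem latticeHom_inversionHom (m : ℕ) (k : Multiplicative ℤ) (v : Fin m → Multiplicative ℤ) :
    latticeHom m (inversionHom m k v) =
      PresentedGroup.of (Fin.last m) ^ k.toAdd * latticeHom m v *
        (PresentedGroup.of (Fin.last m) ^ k.toAdd)⁻¹ := by
  obtain ⟨k, rfl⟩ := Multiplicative.ofAdd.surjective k
  rw [toAdd_ofAdd]
  induction k generalizing v with
  | zero => simp
  | succ k ih =>
    rw [ofAdd_add, map_mul, MulAut.mul_apply, ih, inversionHom_ofAdd_one, latticeHom_inv,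
      zpow_add, zpow_one]
    group
  | pred k ih =>
    have h := latticeHom_inv m v⁻¹
    rw [inv_inv] at h
    have hv : (inversionHom m (Multiplicative.ofAdd 1))⁻¹ v = v⁻¹ :=
      (MulEquiv.symm_apply_eq _).mpr (by rw [inversionHom_ofAdd_one, inv_inv])
    rw [sub_eq_add_neg, ofAdd_add, map_mul, MulAut.mul_apply, ih, ofAdd_neg, map_inv, hv, h,
      zpow_add, zpow_neg_one]
    group

/-- The homomorphism from the deck group to the presented group, inverse to the canonical one. -/
def deckToPresented (m : ℕ) : DeckGroup m →* PresentedGroup (relators (m + 1)) :=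
  SemidirectProduct.lift (latticeHom m) (zpowersHom _ (PresentedGroup.of (Fin.last m))) (by
    intro k
    ext v
    simpa [← map_zpow] using latticeHom_inversionHom m k v)

theorem deckToPresented_deckGen (m : ℕ) (j : Fin (m + 1)) :
    deckToPresented m (deckGen m j) = PresentedGroup.of j := by
  refine Fin.lastCases ?_ (fun i => ?_) j
  · simp [deckToPresented]
  · simp [deckToPresented, latticeHom_mulSingle]

theorem deckGroup_hom_ext {H : Type*} [Group H] {m : ℕ} {φ ψ : DeckGroup m →* H}
    (h : ∀ j, φ (deckGen m j) = ψ (deckGen m j)) : φ = ψ := by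
  apply SemidirectProduct.hom_ext
  · refine MonoidHom.pi_ext fun i x => ?_
    have hi := h i.castSucc
    rw [deckGen_castSucc] at hi
    have hx : (Pi.mulSingle i x : Fin m → Multiplicative ℤ) =
        Pi.mulSingle i (Multiplicative.ofAdd 1) ^ x.toAdd := by
      rw [← Pi.mulSingle_zpow, ← ofAdd_zsmul]; simp
    simp only [hx, map_zpow, MonoidHom.comp_apply, hi]
  · ext
    simpa using h (Fin.last m)

/-- The group presented by the Klein bottle relators is `ℤ^m ⋊ ℤ`. -/
def presentedEquivDeck (m : ℕ) : PresentedGroup (relators (m + 1)) ≃* DeckGroup m :=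
  MonoidHom.toMulEquiv (PresentedGroup.toGroup (deckGen_relators m)) (deckToPresented m)
    (PresentedGroup.ext fun j => by simp [deckToPresented_deckGen])
    (deckGroup_hom_ext fun j => by simp [deckToPresented_deckGen])

theorem presentedEquivDeck_of (m : ℕ) (j : Fin (m + 1)) :
    presentedEquivDeck m (PresentedGroup.of j) = deckGen m j :=
  PresentedGroup.toGroup.of (deckGen_relators m)


/-! ### The universal cover and its deck group. -/

/-- The action of `ℤ^m ⋊ ℤ` on `ℝ^(m+1)` by deck transformations. -/
noncomputable def deckSMul {m : ℕ} (g : DeckGroup m) (x : Fin (m + 1) → ℝ) : Fin (m + 1) → ℝ :=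
  Fin.lastCases (x (Fin.last m) - g.right.toAdd)
    (fun i => (-1) ^ g.right.toAdd * x i.castSucc - (g.left i).toAdd)

noncomputable instance (m : ℕ) : SMul (DeckGroup m) (Fin (m + 1) → ℝ) := ⟨deckSMul⟩

@[simp] theorem deck_smul_last {m : ℕ} (g : DeckGroup m) (x : Fin (m + 1) → ℝ) :
    (g • x) (Fin.last m) = x (Fin.last m) - g.right.toAdd := by
  change deckSMul g x _ = _
  simp [deckSMul]

@[simp] theorem deck_smul_castSucc {m : ℕ} (g : DeckGroup m) (x : Fin (m + 1) → ℝ) (i : Fin m) :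
    (g • x) i.castSucc = (-1) ^ g.right.toAdd * x i.castSucc - (g.left i).toAdd := by
  change deckSMul g x _ = _
  simp [deckSMul]

noncomputable instance (m : ℕ) : MulAction (DeckGroup m) (Fin (m + 1) → ℝ) where
  one_smul x := by
    funext j
    refine Fin.lastCases ?_ (fun i => ?_) j <;> simp
  mul_smul g h x := by
    funext j
    refine Fin.lastCases ?_ (fun i => ?_) j
    · simp; ring
    · simp [toAdd_inversionHom, zpow_add₀]; ring

/-- The universal cover of the torus by `ℝ^(m+1)`; the last coordinate has period `2`, the others
have period `1`. -/
noncomputable def torusCover (m : ℕ) (x : Fin (m + 1) → ℝ) : Torus (m + 1) :=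
  fun j => Circle.exp ((if (j : ℕ) + 1 = m + 1 then Real.pi else 2 * Real.pi) * x j)

@[simp] theorem torusCover_last {m : ℕ} (x : Fin (m + 1) → ℝ) :
    torusCover m x (Fin.last m) = Circle.exp (Real.pi * x (Fin.last m)) := by
  simp [torusCover]

@[simp] theorem torusCover_castSucc {m : ℕ} (x : Fin (m + 1) → ℝ) (i : Fin m) :
    torusCover m x i.castSucc = Circle.exp (2 * Real.pi * x i.castSucc) := by
  have := i.2.ne
  simp [torusCover, this]

theorem torusCover_single (m : ℕ) (j : Fin (m + 1)) (t : unitInterval) :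
    torusCover m (Pi.single j (t : ℝ)) =
      arc (m + 1) j (if (j : ℕ) + 1 = m + 1 then Real.pi else 2 * Real.pi) t := by
  funext i
  by_cases h : i = j
  · subst h; simp [torusCover, arc]
  · simp [torusCover, arc, h]

theorem isOpenQuotientMap_torusCover (m : ℕ) : IsOpenQuotientMap (torusCover m) := by
  refine IsOpenQuotientMap.piMap (f := fun (j : Fin (m + 1)) (x : ℝ) =>
    Circle.exp ((if (j : ℕ) + 1 = m + 1 then Real.pi else 2 * Real.pi) * x)) fun j => ?_
  have hc : (if (j : ℕ) + 1 = m + 1 then Real.pi else 2 * Real.pi) ≠ 0 := by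
    split_ifs <;> positivity
  have hexp : IsOpenQuotientMap Circle.exp :=
    ⟨Circle.exp_surjective, Circle.exp.continuous, isLocalHomeomorph_circleExp.isOpenMap⟩
  exact hexp.comp (Homeomorph.mulLeft₀ _ hc).isOpenQuotientMap

/-- The universal covering map `ℝ^(m+1) → K_(m+1)`. -/
noncomputable def kleinCover (m : ℕ) (x : Fin (m + 1) → ℝ) : K (m + 1) :=
  proj (m + 1) (torusCover m x)

theorem circleExp_eq_iff {c x y : ℝ} (hc : c ≠ 0) :
    Circle.exp (c * x) = Circle.exp (c * y) ↔ ∃ k : ℤ, x = y + k * (2 * Real.pi / c) := by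
  rw [Circle.exp_eq_exp]
  refine exists_congr fun k => ?_
  rw [← mul_right_inj' hc (b := x)]
  have : c * (y + k * (2 * Real.pi / c)) = c * y + k * (2 * Real.pi) := by field_simp
  rw [this]

theorem torusCover_eq_iff {m : ℕ} {x y : Fin (m + 1) → ℝ} :
    torusCover m x = torusCover m y ↔
      (∃ k : ℤ, x (Fin.last m) = y (Fin.last m) + 2 * k) ∧
        ∀ i : Fin m, ∃ k : ℤ, x i.castSucc = y i.castSucc + k := by
  have hπ := Real.pi_ne_zero
  rw [funext_iff, Fin.forall_fin_succ', and_comm]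
  simp only [torusCover_last, torusCover_castSucc, circleExp_eq_iff hπ,
    circleExp_eq_iff (mul_ne_zero two_ne_zero hπ)]
  rw [div_self (mul_ne_zero two_ne_zero hπ), mul_div_cancel_right₀ _ hπ]
  simp only [mul_one, mul_comm]

theorem involution_torusCover (m : ℕ) (x : Fin (m + 1) → ℝ) :
    involution (m + 1) (torusCover m x) =
      torusCover m ((SemidirectProduct.inr (Multiplicative.ofAdd (-1)) : DeckGroup m) • x) := by
  funext j
  refine Fin.lastCases ?_ (fun i => ?_) j
  · simp only [involution, Fin.val_last, if_true, torusCover_last, deck_smul_last]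
    apply Circle.ext
    simp [mul_add, Complex.exp_pi_mul_I]
  · have := i.2.ne
    simp [involution, this]

theorem torusCover_smul_of_even {m : ℕ} (g : DeckGroup m) (hg : Even g.right.toAdd)
    (x : Fin (m + 1) → ℝ) : torusCover m (g • x) = torusCover m x := by
  obtain ⟨r, hr⟩ := hg
  refine torusCover_eq_iff.mpr ⟨⟨-r, ?_⟩, fun i => ⟨-(g.left i).toAdd, ?_⟩⟩
  · simp [hr]; ring
  · simp [hr, Even.neg_one_zpow ⟨r, rfl⟩]; ring

theorem kleinCover_smul {m : ℕ} (g : DeckGroup m) (x : Fin (m + 1) → ℝ) :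
    kleinCover m (g • x) = kleinCover m x := by
  rcases Int.even_or_odd g.right.toAdd with hg | hg
  · exact congrArg (proj (m + 1)) (torusCover_smul_of_even g hg x)
  · refine proj_eq_iff.mpr (Or.inr ?_)
    -- The involution lifts to an odd element, whose product with the odd `g` is even.
    rw [involution_torusCover, ← mul_smul, torusCover_smul_of_even]
    rw [SemidirectProduct.mul_right, toAdd_mul, SemidirectProduct.right_inr, toAdd_ofAdd]
    exact Odd.add_odd (by decide) hg

theorem mem_orbit_of_torusCover_eq {m : ℕ} {x y : Fin (m + 1) → ℝ}
    (h : torusCover m x = torusCover m y) : x ∈ MulAction.orbit (DeckGroup m) y := by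
  obtain ⟨⟨k, hk⟩, hv⟩ := torusCover_eq_iff.mp h
  choose v hv using hv
  -- The action subtracts, hence the signs; the last entry is even, so no coordinate is negated.
  refine ⟨⟨fun i => Multiplicative.ofAdd (-v i), Multiplicative.ofAdd (-(2 * k))⟩, ?_⟩
  funext j
  beta_reduce
  refine Fin.lastCases ?_ (fun i => ?_) j
  · rw [deck_smul_last, hk]
    simp only [toAdd_ofAdd]
    push_cast
    ring
  · rw [deck_smul_castSucc, hv]
    simp only [toAdd_ofAdd]
    rw [Even.neg_one_zpow (even_two_mul k).neg]
    push_cast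
    ring

theorem kleinCover_eq_iff {m : ℕ} {x y : Fin (m + 1) → ℝ} :
    kleinCover m x = kleinCover m y ↔ x ∈ MulAction.orbit (DeckGroup m) y := by
  constructor
  · intro h
    rcases proj_eq_iff.mp h.symm with h | h
    · exact mem_orbit_of_torusCover_eq h
    · rw [involution_torusCover] at h
      have := mem_orbit_of_torusCover_eq h
      rwa [MulAction.orbit_smul] at this
  · rintro ⟨g, rfl⟩
    exact kleinCover_smul g y

theorem deck_eq_one_of_dist_lt {m : ℕ} {g : DeckGroup m} {x : Fin (m + 1) → ℝ}
    (h : dist (g • x) x < 1) : g = 1 := by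
  have hint (k : ℤ) (hk : |(k : ℝ)| < 1) : k = 0 := Int.abs_lt_one_iff.mp (by exact_mod_cast hk)
  have hj (j : Fin (m + 1)) : |(g • x) j - x j| < 1 := by
    rw [← Real.dist_eq]; exact (dist_le_pi_dist _ _ j).trans_lt h
  -- The last coordinate goes first: only once no negation occurs are the other displacements
  -- integers.
  have hr : g.right = 1 := hint g.right.toAdd (by simpa using hj (Fin.last m))
  ext i
  · exact hint (g.left i).toAdd (by simpa [hr] using hj i.castSucc)
  · rw [hr]; rfl

theorem isQuotientCoveringMap_kleinCover (m : ℕ) :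
    IsQuotientCoveringMap (kleinCover m) (DeckGroup m) where
  toIsQuotientMap := (isQuotientMap_proj _).comp (isOpenQuotientMap_torusCover m).isQuotientMap
  continuous_const_smul g := by
    refine continuous_pi fun j => ?_
    refine Fin.lastCases ?_ (fun i => ?_) j
    · simp only [deck_smul_last]; fun_prop
    · simp only [deck_smul_castSucc]; fun_prop
  apply_eq_iff_mem_orbit := kleinCover_eq_iff
  disjoint x := by
    refine ⟨Metric.ball x (1 / 2), Metric.ball_mem_nhds _ (by norm_num), ?_⟩
    rintro g ⟨_, ⟨y, hy, rfl⟩, hgy⟩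
    refine deck_eq_one_of_dist_lt (x := y) ?_
    calc dist (g • y) y ≤ dist (g • y) x + dist y x := dist_triangle_right _ _ _
      _ < 1 / 2 + 1 / 2 := add_lt_add hgy hy
      _ = 1 := by norm_num

theorem kleinCover_single (m : ℕ) (j : Fin (m + 1)) (t : unitInterval) :
    kleinCover m (Pi.single j (t : ℝ)) = kleinLoop (m + 1) j t := by
  rw [kleinCover, torusCover_single]; rfl

theorem kleinCover_zero (m : ℕ) : kleinCover m 0 = proj (m + 1) 1 := by
  simpa using kleinCover_single m 0 0

/-! ### Identification of the fundamental group. -/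

/-- The segment from the origin to the `j`-th basis vector. -/
noncomputable def basisSegment (m : ℕ) (j : Fin (m + 1)) :
    Path (0 : Fin (m + 1) → ℝ) (Pi.single j 1) where
  toFun t := Pi.single j (t : ℝ)
  continuous_toFun := (continuous_single j).comp continuous_subtype_val
  source' := by simp
  target' := by simp

theorem deckGen_inv_smul_zero (m : ℕ) (j : Fin (m + 1)) :
    (deckGen m j)⁻¹ • (0 : Fin (m + 1) → ℝ) = Pi.single j 1 := by
  rw [inv_smul_eq_iff]
  funext l
  refine Fin.lastCases ?_ (fun i => ?_) j <;> refine Fin.lastCases ?_ (fun i' => ?_) l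
  · simp
  · simp [(Fin.castSucc_lt_last _).ne]
  · simp [(Fin.castSucc_lt_last _).ne']
  · by_cases h : i' = i
    · subst h; simp
    · simp [h]

/-- The origin as a point of the fibre over the base point. -/
def originLift (m : ℕ) : kleinCover m ⁻¹' {proj (m + 1) 1} := ⟨0, kleinCover_zero m⟩

/-- The fundamental group of the Klein bottle is the deck transformation group. -/
noncomputable def fundamentalGroupEquivDeck (m : ℕ) :
    FundamentalGroup (K (m + 1)) (proj (m + 1) 1) ≃* DeckGroup m :=
  ((isQuotientCoveringMap_kleinCover m).fundamentalGroupEquiv (originLift m)).trans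
    -- Monodromy gives the opposite group. Inversion undoes this, and the minus signs in the action
    -- make `a_j` land on the generator rather than its inverse.
    (MulEquiv.inv' (DeckGroup m)).symm

theorem fundamentalGroupEquivDeck_a (m : ℕ) (j : Fin (m + 1)) :
    fundamentalGroupEquivDeck m (a (m + 1) j) = deckGen m j := by
  have hp := isQuotientCoveringMap_kleinCover m
  have hend : kleinCover m (Pi.single j 1) = proj (m + 1) 1 := by
    rw [← deckGen_inv_smul_zero, kleinCover_smul, kleinCover_zero]
  rw [fundamentalGroupEquivDeck, MulEquiv.trans_apply, MulEquiv.symm_apply_eq]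
  refine (hp.fundamentalGroupToMulOpposite_apply_eq_Iff (e := originLift m)).mpr ?_
  refine (deckGen_inv_smul_zero m j).trans ?_
  -- The segment lifts `f_j`, so monodromy along `f_j` takes the origin to its endpoint.
  refine congrArg Subtype.val (hp.isCoveringMap.monodromy_eq_of_map_eq
    (ey := ⟨Pi.single j 1, hend⟩)
    (Path.Homotopic.Quotient.mk (basisSegment m j)) ?_).symm
  refine congrArg Path.Homotopic.Quotient.mk (?_ : _ = (kleinLoop (m + 1) j).cast _ _)
  ext t
  exact kleinCover_single m j t

end KleinBottle

theorem mainTheorem9 (n : ℕ) (hn : 1 ≤ n) :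
    (∃ φ : PresentedGroup (KleinBottle.relators n) ≃*
          FundamentalGroup (KleinBottle.K n) (KleinBottle.proj n 1),
        ∀ j : Fin n, φ (PresentedGroup.of j) = KleinBottle.a n j) ∧
      IsCoveringMap (KleinBottle.proj n) ∧
      (∀ x : KleinBottle.K n, (KleinBottle.proj n ⁻¹' {x}).ncard = 2) ∧
      (∀ j : Fin n,
        FundamentalGroup.map (KleinBottle.proj n) 1 (KleinBottle.g n j) =
          if (j : ℕ) + 1 = n then KleinBottle.a n j ^ 2 else KleinBottle.a n j) := by
  refine ⟨?_, KleinBottle.isCoveringMap_proj hn, KleinBottle.ncard_preimage_proj hn,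
    KleinBottle.map_proj_g n⟩
  obtain ⟨m, rfl⟩ := Nat.exists_eq_add_of_le' hn
  refine ⟨(KleinBottle.presentedEquivDeck m).trans
    (KleinBottle.fundamentalGroupEquivDeck m).symm, fun j => ?_⟩
  rw [MulEquiv.trans_apply, KleinBottle.presentedEquivDeck_of, MulEquiv.symm_apply_eq,
    KleinBottle.fundamentalGroupEquivDeck_a]
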